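/- Let $\mathcal M$ be a matroid of rank $k$ on a finite set $\{1,\dots,n\}$, without loops. Let $f_{j-1}$ be the number of its independent sets of size $j$, and define its $h$-vector $(h_0,\dots,h_k)$ by $$h_i(\mathcal M)=\sum_{j=0}^{i}(-1)^{i-j}\binom{k-j}{k-i}f_{j-1},\qquad 0\le i\le k .$$ A sequence of non-negative integers $(h_1,\dots,h_k)$ is called a pure $O$-sequence if $h_k>0$ and there exist monomials $m_1,\dots,m_{h_k}$ of degree $k$ in variables $x_1,\dots,x_{h_1}$ such that, for each $1\le l\le k$, the number of monomials of degree $l$ in $x_1,\dots,x_{h_1}$ that divide at least one of the $m_a$ equals $h_l$ (for $k=0$ the empty sequence counts as pure). Stanley's conjecture states that for every $n$, every $k$ and every loopless and coloop-free matroid $\mathcal M$ of rank $k$ on $\{1,\dots,n\}$, the sequence $(h_1(\mathcal M),\dots,h_k(\mathcal M))$ is a pure $O$-sequence. **Corollary.** Stanley's conjecture implies the following. For every $n$, every $k$ and every loopless and coloop-free matroid $\mathcal M$ of rank $k$ on $\{1,\dots,n\}$, writing $h_i=h_i(\mathcal M)$ and $g_i=h_i-h_{i-1}$: 1. $h_i\le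 h_j$ whenever $0\le i\le j\le k-i$; 2. (the $g$-inequalities) $g_i\ge 0$ for $1\le i\le\lfloor k/2\rfloor$; and, for $1\le i<\lfloor k/2\rfloor$, if $$g_i=\binom{n_i}{i}+\binom{n_{i-1}}{i-1}+\dots+\binom{n_r}{r},\qquad n_i>n_{i-1}>\dots>n_r\ge r\ge 1,$$ then $$g_{i+1}\le\binom{n_i+1}{i+1}+\binom{n_{i-1}+1}{i}+\dots+\binom{n_r+1}{r+1},$$ where $g_i=0$ is written as the empty sum, so that $g_i=0$ implies $g_{i+1}\le 0$. -/

import Mathlib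

namespace MatroidH

/-- The number of independent sets of size `j` of `M`, i.e. the number `f_{j-1}` of
`(j-1)`-dimensional faces of the complex of independent sets of `M`. -/
noncomputable def numFaces {n : ℕ} (M : Matroid (Fin n)) (j : ℕ) : ℕ :=
  {F : Finset (Fin n) | F.card = j ∧ M.Indep (F : Set (Fin n))}.ncard

/-- The entry `h_i`, for `0 ≤ i ≤ k`, of the `h`-vector of a rank `k` matroid:
`h_i = ∑_{j ≤ i} (-1)^{i-j} * C(k-j, k-i) * f_{j-1}`, equivalently
`∑_i h_i x^{k-i} = ∑_j f_{j-1} (x-1)^{k-j}`. -/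
noncomputable def hNumber {n : ℕ} (M : Matroid (Fin n)) (k i : ℕ) : ℤ :=
  ∑ j ∈ Finset.range (i + 1),
    (-1) ^ (i - j) * ((k - j).choose (k - i) : ℤ) * (numFaces M j : ℤ)

/-- `(h 1, ..., h k)` is a pure O-sequence. Monomials in the variables `x_1, ..., x_{h 1}` are
given by their exponent vectors, so that divisibility is `≤`. Only the values of `h` at the
positions `1, ..., k` matter for `k ≥ 1`. -/
def IsPureOSequence (k : ℕ) (h : ℕ → ℕ) : Prop :=
  0 < h k ∧ ∃ m : Fin (h k) → (Fin (h 1) →₀ ℕ),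
    (∀ a, (m a).degree = k) ∧
    ∀ l, 1 ≤ l → l ≤ k →
      h l = {q : Fin (h 1) →₀ ℕ | q.degree = l ∧ ∃ a, q ≤ m a}.ncard

/-- `g_i = h_i - h_{i-1}`, for `i ≥ 1`. -/
def gNumber (h : ℕ → ℤ) (i : ℕ) : ℤ := h i - h (i - 1)

/-- The `g`-inequalities for `(h 0, ..., h k)`. In the binomial expansion
`g_i = C(n_i, i) + C(n_{i-1}, i-1) + ... + C(n_r, r)` the value `r = i + 1` stands for the empty
sum, the expansion of `g_i = 0`. -/
def GInequalities (k : ℕ) (h : ℕ → ℤ) : Prop :=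
  (∀ i, 1 ≤ i → i ≤ k / 2 → 0 ≤ gNumber h i) ∧
  ∀ i, 1 ≤ i → i < k / 2 →
    ∀ (r : ℕ) (n : ℕ → ℕ), 1 ≤ r → r ≤ i + 1 →
      StrictMonoOn n (Set.Icc r i) → (r ≤ i → r ≤ n r) →
      gNumber h i = ∑ s ∈ Finset.Icc r i, ((n s).choose s : ℤ) →
      gNumber h (i + 1) ≤ ∑ s ∈ Finset.Icc r i, ((n s + 1).choose (s + 1) : ℤ)

/-- Stanley's conjecture: the `h`-vector `(h_1, ..., h_k)` of every coloop-free matroid of rank `k`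
on a vertex set `{1, ..., n}` is a pure O-sequence. -/
def StanleyConjecture : Prop :=
  ∀ (n k : ℕ) (M : Matroid (Fin n)), M.E = Set.univ → M.Loopless → (∀ e, ¬ M.IsColoop e) →
    M.eRank = (k : ℕ∞) →
    ∃ h : ℕ → ℕ, IsPureOSequence k h ∧ ∀ i, 1 ≤ i → i ≤ k → hNumber M k i = (h i : ℤ)

end MatroidH

/-! Stanley's conjecture makes h_i the number of degree i divisors of finitely many monomials m_a,
all of degree k; matroids play no further role. Let A be the quotient of ℚ[x] spanned by these
divisors and L multiplication by the sum of the variables. A embeds in the product of the algebras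
ℚ[x]/(x_j^{m_a(j)+1}), each of which carries an sl₂-triple with raising operator L. Hence L^s is
injective on A_i when s + 2i ≤ k (`eq_zero_of_pow_raise_divisors`), and s = j - i gives h_i ≤ h_j.

For the g-inequalities, transpose: `contract`, the dual of L, is onto from degree l + 1 to degree l
when 2l + 1 ≤ k, so g_{l+1} is the dimension of its kernel. These kernels are stable under the
shifts f ↦ f(· + e_j), so their lexicographic leading monomials form an order ideal
(`mem_leading_of_add_single`), counted by g_i in the lower half. Macaulay's bound for such families,
proved by compression (`macaulayBound`), finishes the proof. -/

namespace MonomialShadow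

open Finsupp

variable {σ : Type*}

/-! ### Fibres and compression of families of monomials -/

theorem exists_add_single (u : σ →₀ ℕ) {j : σ} (h : u j ≠ 0) : ∃ v, u = v + single j 1 := by
  refine ⟨u - single j 1, (tsub_add_cancel_of_le ?_).symm⟩
  rw [Finsupp.single_le_iff]
  omega

/-- `u` and `v` have the same total degree in `x, y` and agree in the other variables. -/
def SameFibre (x y : σ) (u v : σ →₀ ℕ) : Prop :=
  (∀ i, i ≠ x → i ≠ y → u i = v i) ∧ u x + u y = v x + v y

theorem SameFibre.symm {x y : σ} {u v : σ →₀ ℕ} (h : SameFibre x y u v) : SameFibre x y v u :=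
  ⟨fun i h1 h2 => (h.1 i h1 h2).symm, h.2.symm⟩

theorem SameFibre.trans {x y : σ} {u v w : σ →₀ ℕ} (h : SameFibre x y u v)
    (h' : SameFibre x y v w) : SameFibre x y u w :=
  ⟨fun i h1 h2 => (h.1 i h1 h2).trans (h'.1 i h1 h2), h.2.trans h'.2⟩

theorem SameFibre.eq {x y : σ} {u v : σ →₀ ℕ} (h : SameFibre x y u v) (hy : u y = v y) :
    u = v := by
  ext i
  by_cases h1 : i = x
  · have := h.2
    subst h1
    omega
  · by_cases h2 : i = y
    · rw [h2, hy]
    · exact h.1 i h1 h2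

open Classical in
/-- The members of `A` in the `x, y`-fibre of `u`. -/
noncomputable def fibre (x y : σ) (A : Finset (σ →₀ ℕ)) (u : σ →₀ ℕ) : Finset (σ →₀ ℕ) :=
  A.filter (SameFibre x y u)

theorem mem_fibre {x y : σ} {A : Finset (σ →₀ ℕ)} {u v : σ →₀ ℕ} :
    v ∈ fibre x y A u ↔ v ∈ A ∧ SameFibre x y u v := by
  simp [fibre]

theorem fibre_congr {x y : σ} {A : Finset (σ →₀ ℕ)} {u v : σ →₀ ℕ} (h : SameFibre x y u v) :
    fibre x y A u = fibre x y A v := by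
  ext w
  simp only [mem_fibre]
  exact and_congr_right fun _ => ⟨h.symm.trans, h.trans⟩

theorem eq_of_mem_fibre {x y : σ} {A : Finset (σ →₀ ℕ)} {u v w : σ →₀ ℕ}
    (hv : v ∈ fibre x y A u) (hw : w ∈ fibre x y A u) (h : v y = w y) : v = w :=
  ((mem_fibre.1 hv).2.symm.trans (mem_fibre.1 hw).2).eq h

/-- The position of `u` in its fibre, ordered by the exponent of `y`. -/
noncomputable def fibreRank (x y : σ) (A : Finset (σ →₀ ℕ)) (u : σ →₀ ℕ) : ℕ :=
  ((fibre x y A u).filter fun v => v y < u y).card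

theorem fibreRank_le (x y : σ) (A : Finset (σ →₀ ℕ)) (u : σ →₀ ℕ) : fibreRank x y A u ≤ u y := by
  have h : ((fibre x y A u).filter fun v => v y < u y).card ≤ (Finset.range (u y)).card := by
    refine Finset.card_le_card_of_injOn (fun v => v y) ?_ ?_
    · intro v hv
      simpa using (Finset.mem_filter.1 hv).2
    · intro v hv w hw hvw
      exact eq_of_mem_fibre (Finset.mem_filter.1 hv).1 (Finset.mem_filter.1 hw).1 hvw
  rwa [Finset.card_range] at h

theorem fibreRank_lt_card {x y : σ} {A : Finset (σ →₀ ℕ)} {u : σ →₀ ℕ} (hu : u ∈ A) :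
    fibreRank x y A u < (fibre x y A u).card := by
  refine Finset.card_lt_card ((Finset.filter_ssubset).2 ⟨u, ?_, by simp⟩)
  exact mem_fibre.2 ⟨hu, fun _ _ _ => rfl, rfl⟩

theorem fibreRank_lt {x y : σ} {A : Finset (σ →₀ ℕ)} {u v : σ →₀ ℕ} (hu : u ∈ A)
    (h : SameFibre x y u v) (hlt : u y < v y) : fibreRank x y A u < fibreRank x y A v := by
  refine Finset.card_lt_card ((Finset.ssubset_iff_of_subset ?_).2 ⟨u, ?_, ?_⟩)
  · intro w hw
    rw [Finset.mem_filter, fibre_congr h] at hw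
    exact Finset.mem_filter.2 ⟨hw.1, hw.2.trans hlt⟩
  · exact Finset.mem_filter.2 ⟨mem_fibre.2 ⟨hu, h.symm⟩, hlt⟩
  · simp

theorem fibreRank_injOn (x y : σ) (A : Finset (σ →₀ ℕ)) (w : σ →₀ ℕ) :
    Set.InjOn (fibreRank x y A) (fibre x y A w) := by
  intro u hu v hv huv
  have hu' := mem_fibre.1 hu
  have hv' := mem_fibre.1 hv
  have huv' := hu'.2.symm.trans hv'.2
  refine huv'.eq ?_
  rcases lt_trichotomy (u y) (v y) with h | h | h
  · exact absurd huv (fibreRank_lt hu'.1 huv' h).ne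
  · exact h
  · exact absurd huv (fibreRank_lt hv'.1 huv'.symm h).ne'

theorem exists_fibreRank_eq {x y : σ} {A : Finset (σ →₀ ℕ)} {w : σ →₀ ℕ} {t : ℕ}
    (ht : t < (fibre x y A w).card) : ∃ u ∈ fibre x y A w, fibreRank x y A u = t := by
  have h : (fibre x y A w).image (fibreRank x y A) = Finset.range (fibre x y A w).card := by
    refine Finset.eq_of_subset_of_card_le ?_ ?_
    · intro s hs
      obtain ⟨u, hu, rfl⟩ := Finset.mem_image.1 hs
      rw [Finset.mem_range, fibre_congr (mem_fibre.1 hu).2]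
      exact fibreRank_lt_card (mem_fibre.1 hu).1
    · rw [Finset.card_image_of_injOn (fibreRank_injOn x y A w), Finset.card_range]
  have := Finset.mem_range.2 ht
  rw [← h] at this
  exact Finset.mem_image.1 this

variable [DecidableEq σ]

/-- Replace the exponent of `y` by the position in the fibre, keeping the fibre. -/
noncomputable def push (x y : σ) (A : Finset (σ →₀ ℕ)) (u : σ →₀ ℕ) : σ →₀ ℕ :=
  (u.update y (fibreRank x y A u)).update x (u x + u y - fibreRank x y A u)

theorem push_apply_left (x y : σ) (A : Finset (σ →₀ ℕ)) (u : σ →₀ ℕ) :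
    push x y A u x = u x + u y - fibreRank x y A u := by
  simp [push]

theorem push_apply_right {x y : σ} (hxy : y ≠ x) (A : Finset (σ →₀ ℕ)) (u : σ →₀ ℕ) :
    push x y A u y = fibreRank x y A u := by
  simp [push, hxy]

theorem sameFibre_push {x y : σ} (hxy : y ≠ x) (A : Finset (σ →₀ ℕ)) (u : σ →₀ ℕ) :
    SameFibre x y u (push x y A u) := by
  refine ⟨fun i h1 h2 => by simp [push, h1, h2], ?_⟩
  rw [push_apply_left, push_apply_right hxy]
  have := fibreRank_le x y A u
  omega

theorem push_injOn {x y : σ} (hxy : y ≠ x) (A : Finset (σ →₀ ℕ)) : Set.InjOn (push x y A) A := by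
  intro u hu v hv huv
  have h1 := sameFibre_push hxy A u
  have h2 := sameFibre_push hxy A v
  have h3 : fibreRank x y A u = fibreRank x y A v := by
    rw [← push_apply_right hxy, ← push_apply_right hxy, huv]
  rw [huv] at h1
  exact fibreRank_injOn x y A v (mem_fibre.2 ⟨hu, h2.trans h1.symm⟩)
    (mem_fibre.2 ⟨hv, fun _ _ _ => rfl, rfl⟩) h3

/-- The compression of `A` towards `x` in the `x, y`-fibres. -/
noncomputable def compress (x y : σ) (A : Finset (σ →₀ ℕ)) : Finset (σ →₀ ℕ) :=
  A.image (push x y A)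

theorem card_compress {x y : σ} (hxy : y ≠ x) (A : Finset (σ →₀ ℕ)) :
    (compress x y A).card = A.card :=
  Finset.card_image_of_injOn (push_injOn hxy A)

/-- The ranks in a fibre are 0, 1, 2, ... without gaps, so compression turns each fibre into an
initial segment for the exponent of `y`. -/
theorem mem_compress {x y : σ} (hxy : y ≠ x) {A : Finset (σ →₀ ℕ)} {w : σ →₀ ℕ} :
    w ∈ compress x y A ↔ w y < (fibre x y A w).card := by
  constructor
  · intro h
    obtain ⟨u, hu, rfl⟩ := Finset.mem_image.1 h
    rw [← fibre_congr (sameFibre_push hxy A u), push_apply_right hxy]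
    exact fibreRank_lt_card hu
  · intro h
    obtain ⟨u, hu, hr⟩ := exists_fibreRank_eq h
    refine Finset.mem_image.2 ⟨u, (mem_fibre.1 hu).1, ?_⟩
    exact (((mem_fibre.1 hu).2.trans (sameFibre_push hxy A u)).symm).eq
      (by rw [push_apply_right hxy, hr])

theorem SameFibre.degree_eq {x y : σ} (hxy : y ≠ x) {u v : σ →₀ ℕ} (h : SameFibre x y u v) :
    u.degree = v.degree := by
  have key : ∀ w : σ →₀ ℕ, ∀ S : Finset σ, x ∈ S → y ∈ S → w.support ⊆ S →
      w.degree = w x + w y + ∑ i ∈ (S.erase x).erase y, w i := by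
    intro w S hx hy hS
    rw [Finsupp.degree_apply, Finset.sum_subset hS (by simp), ← Finset.add_sum_erase _ _ hx,
      ← Finset.add_sum_erase _ _ (Finset.mem_erase.2 ⟨hxy, hy⟩), add_assoc]
  rw [key u (u.support ∪ v.support ∪ {x, y}) (by simp) (by simp) (by intro; simp; tauto),
    key v (u.support ∪ v.support ∪ {x, y}) (by simp) (by simp) (by intro; simp; tauto), h.2]
  congr 1
  refine Finset.sum_congr rfl fun i hi => ?_
  simp only [Finset.mem_erase] at hi
  exact h.1 i hi.2.1 hi.1

/-! ### Compression, shadows and stability -/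

/-- All monomials obtained by dividing a member of `A` by a variable lie in `B`. -/
def ShadowSubset (A B : Finset (σ →₀ ℕ)) : Prop := ∀ v j, v + single j 1 ∈ A → v ∈ B

/-- `A` is closed under replacing a variable by `x`. -/
def Stable (x : σ) (A : Finset (σ →₀ ℕ)) : Prop :=
  ∀ v j, v + single j 1 ∈ A → v + single x 1 ∈ A

theorem sameFibre_add_single (x y : σ) (v : σ →₀ ℕ) :
    SameFibre x y (v + single x 1) (v + single y 1) := by
  refine ⟨fun i h1 h2 => by simp [Ne.symm h1, Ne.symm h2], ?_⟩
  by_cases h : x = y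
  · subst h; rfl
  · simp [h, Ne.symm h]
    omega

/-- Let M = v x + v y. A fibre of `A` is a set S of `y`-exponents in {0, ..., M + 1}, and its shadow
is (S ∪ (S - 1)) ∩ {0, ..., M}. This is at least as large as S unless S is everything, and then it
has M + 1 > v y elements. -/
theorem lt_card_fibre {x y : σ} (hxy : y ≠ x) {A B : Finset (σ →₀ ℕ)} (h : ShadowSubset A B)
    {v : σ →₀ ℕ} (hv : v y < (fibre x y A (v + single x 1)).card) :
    v y < (fibre x y B v).card := by
  have hx : ∀ u : σ →₀ ℕ, u + single x 1 ∈ fibre x y A (v + single x 1) → u ∈ fibre x y B v := by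
    intro u hu
    rw [mem_fibre] at hu ⊢
    refine ⟨h u x hu.1, fun i h1 h2 => ?_, ?_⟩
    · simpa using hu.2.1 i h1 h2
    · have := hu.2.2
      simp [hxy.symm] at this
      omega
  have hy : ∀ u : σ →₀ ℕ, u + single y 1 ∈ fibre x y A (v + single x 1) → u ∈ fibre x y B v := by
    intro u hu
    rw [fibre_congr (sameFibre_add_single x y v)] at hu
    rw [mem_fibre] at hu ⊢
    refine ⟨h u y hu.1, fun i h1 h2 => ?_, ?_⟩
    · simpa using hu.2.1 i h1 h2
    · have := hu.2.2
      simp [hxy] at this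
      omega
  have hsum : ∀ u ∈ fibre x y A (v + single x 1), u x + u y = v x + v y + 1 := by
    intro u hu
    have := (mem_fibre.1 hu).2.2
    simp [hxy.symm] at this
    omega
  by_cases hg : ∃ g ≤ v x + v y + 1, ∀ u ∈ fibre x y A (v + single x 1), u y ≠ g
  · obtain ⟨g, hgM, hg⟩ := hg
    -- At a gap g, divide by `x` below g and by `y` above it: the resulting `y`-exponents are < g
    -- and ≥ g respectively, so nothing collides.
    refine hv.trans_le (Finset.card_le_card_of_injOn
      (fun u => if u y < g then u - single x 1 else u - single y 1) ?_ ?_)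
    · intro u hu
      have h1 := hsum u hu
      have h2 := hg u hu
      simp only
      split_ifs with hlt
      · obtain ⟨w, rfl⟩ := exists_add_single u (j := x) (by omega)
        simpa using hx w hu
      · obtain ⟨w, rfl⟩ := exists_add_single u (j := y) (by omega)
        simpa using hy w hu
    · intro u hu w hw huw
      have h2 := hg u hu
      have h3 := hg w hw
      refine eq_of_mem_fibre hu hw ?_
      have huw' := DFunLike.congr_fun huw y
      simp only at huw'
      split_ifs at huw' with h4 h5 h5 <;>
        simp [hxy] at huw' <;> omega
  · push Not at hg
    have hsub : Finset.range (v x + v y + 1) ⊆ (fibre x y B v).image fun u => u y := by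
      intro g hgr
      rw [Finset.mem_range] at hgr
      obtain ⟨u, hu, rfl⟩ := hg g (by omega)
      have h1 := hsum u hu
      obtain ⟨w, rfl⟩ := exists_add_single u (j := x) (by omega)
      refine Finset.mem_image.2 ⟨w, hx w hu, ?_⟩
      simp [hxy]
    have := (Finset.card_le_card hsub).trans Finset.card_image_le
    rw [Finset.card_range] at this
    omega

/-- Division by `x` or `y` is covered by `lt_card_fibre`, since v·x and v·y share a fibre. Division
by a third variable maps fibres injectively to fibres. -/
theorem ShadowSubset.compress {x y : σ} (hxy : y ≠ x) {A B : Finset (σ →₀ ℕ)}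
    (h : ShadowSubset A B) : ShadowSubset (compress x y A) (compress x y B) := by
  intro v j hv
  rw [mem_compress hxy] at hv ⊢
  by_cases hjx : j = x
  · subst hjx
    exact lt_card_fibre hxy h (by simpa [hxy] using hv)
  by_cases hjy : j = y
  · subst hjy
    rw [← fibre_congr (sameFibre_add_single x j v)] at hv
    refine lt_card_fibre hxy h (lt_trans ?_ hv)
    simp
  · have h1 : (v + single j 1 : σ →₀ ℕ) y = v y := by simp [hjy]
    rw [h1] at hv
    refine hv.trans_le (Finset.card_le_card_of_injOn (fun u => u - single j 1) ?_ ?_)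
    · intro u hu
      have hu' := mem_fibre.1 hu
      obtain ⟨w, rfl⟩ := exists_add_single u (j := j) (by
        rw [← hu'.2.1 j hjx hjy]; simp)
      simp only [add_tsub_cancel_right]
      refine mem_fibre.2 ⟨h w j hu'.1, fun i h1 h2 => by simpa using hu'.2.1 i h1 h2, ?_⟩
      simpa [hjx, hjy] using hu'.2.2
    · intro u hu w hw huw
      refine eq_of_mem_fibre hu hw ?_
      have := DFunLike.congr_fun huw y
      simpa [hjy] using this

/-- Such an `A` is fixed by every compression towards `x`, and an initial segment containing v·y
contains v·x, whose `y`-exponent is smaller. -/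
theorem stable_of_fibreRank {x : σ} {A : Finset (σ →₀ ℕ)}
    (h : ∀ y, y ≠ x → ∀ u ∈ A, fibreRank x y A u = u y) : Stable x A := by
  intro v y hv
  by_cases hxy : y = x
  · rwa [← hxy]
  have hC : compress x y A = A := by
    refine (Finset.image_congr ?_).trans Finset.image_id
    intro u hu
    exact ((sameFibre_push hxy A u).eq ((push_apply_right hxy A u).trans (h y hxy u hu)).symm).symm
  rw [← hC, mem_compress hxy] at hv ⊢
  rw [fibre_congr (sameFibre_add_single x y v)]
  refine lt_trans ?_ hv
  simp [Ne.symm hxy]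

/-- A compression that moves something strictly lowers the sum of d + 1 - u x, so compressing
terminates. `B` is compressed alongside to keep containing the shadow. -/
theorem exists_stable (x : σ) (V : Finset σ) (d : ℕ) : ∀ (N : ℕ) (A B : Finset (σ →₀ ℕ)),
    ∑ u ∈ A, (d + 1 - u x) ≤ N → ShadowSubset A B →
    (∀ u ∈ A, u.degree = d + 1) → (∀ u ∈ A, u.support ⊆ insert x V) →
    ∃ A' B' : Finset (σ →₀ ℕ), A'.card = A.card ∧ B'.card = B.card ∧ ShadowSubset A' B' ∧
      Stable x A' ∧ (∀ u ∈ A', u.degree = d + 1) ∧ (∀ u ∈ A', u.support ⊆ insert x V) := by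
  intro N
  induction N with
  | zero =>
    intro A B hN hS hd hV
    refine ⟨A, B, rfl, rfl, hS, ?_, hd, hV⟩
    refine stable_of_fibreRank fun y hy u hu => ?_
    have h1 : d + 1 - u x = 0 := by
      have := Finset.single_le_sum (f := fun u : σ →₀ ℕ => d + 1 - u x) (fun _ _ => Nat.zero_le _) hu
      omega
    have h2 : u y = 0 := by
      obtain ⟨w, hw⟩ : ∃ w, u = w + single x (d + 1) :=
        ⟨u - single x (d + 1), (tsub_add_cancel_of_le (Finsupp.single_le_iff.2 (by omega))).symm⟩
      have h3 := hd u hu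
      rw [hw, map_add, Finsupp.degree_single] at h3
      have h4 : w.degree = 0 := by omega
      rw [Finsupp.degree_eq_zero_iff] at h4
      rw [hw, h4]
      simp [Ne.symm hy]
    have := fibreRank_le x y A u
    omega
  | succ N ih =>
    intro A B hN hS hd hV
    by_cases hst : ∀ y, y ≠ x → ∀ u ∈ A, fibreRank x y A u = u y
    · exact ⟨A, B, rfl, rfl, hS, stable_of_fibreRank hst, hd, hV⟩
    push Not at hst
    obtain ⟨y, hy, u, hu, hne⟩ := hst
    have hdx : ∀ w : σ →₀ ℕ, w.degree = d + 1 → w x + w y ≤ d + 1 := by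
      intro w hw
      rw [← hw, Finsupp.degree_apply]
      have h1 : ∑ i ∈ {x, y}, w i ≤ ∑ i ∈ w.support ∪ {x, y}, w i :=
        Finset.sum_le_sum_of_subset Finset.subset_union_right
      rw [Finset.sum_pair (Ne.symm hy)] at h1
      refine h1.trans (le_of_eq ?_)
      exact (Finset.sum_subset Finset.subset_union_left (by simp)).symm
    have hsum : ∑ u ∈ compress x y A, (d + 1 - u x) < ∑ u ∈ A, (d + 1 - u x) := by
      rw [compress, Finset.sum_image (push_injOn hy A)]
      refine Finset.sum_lt_sum (fun w hw => ?_) ⟨u, hu, ?_⟩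
      · rw [push_apply_left]
        have := fibreRank_le x y A w
        omega
      · rw [push_apply_left]
        have := fibreRank_le x y A u
        have := hdx u (hd u hu)
        omega
    obtain ⟨A', B', h1, h2, h3⟩ := ih (compress x y A) (compress x y B) (by omega)
      (hS.compress hy) (by
        intro w hw
        obtain ⟨v, hv, rfl⟩ := Finset.mem_image.1 hw
        rw [← (sameFibre_push hy A v).degree_eq hy, hd v hv]) (by
        intro w hw
        obtain ⟨v, hv, rfl⟩ := Finset.mem_image.1 hw
        intro i hi
        by_cases hix : i = x
        · simp [hix]
        refine hV v hv ?_
        rw [Finsupp.mem_support_iff] at hi ⊢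
        by_cases hiy : i = y
        · subst hiy
          rw [push_apply_right hy] at hi
          have := fibreRank_le x i A v
          omega
        · rwa [(sameFibre_push hy A v).1 i hix hiy])
    exact ⟨A', B', h1.trans (card_compress hy A), h2.trans (card_compress hy B), h3⟩

/-! ### Macaulay's theorem by induction on the variables -/

/-- Macaulay's bound for families of monomials in the variables `V`. -/
def MacaulayBound (V : Finset σ) : Prop :=
  ∀ (d : ℕ) (n : ℕ → ℕ) (A B : Finset (σ →₀ ℕ)), ShadowSubset A B →
    (∀ u ∈ A, u.degree = d + 1) → (∀ u ∈ A, u.support ⊆ V) →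
    B.card ≤ ∑ s ∈ Finset.range d, (n s).choose (s + 1) →
    A.card ≤ ∑ s ∈ Finset.range d, (n s + 1).choose (s + 2)

/-- The monomials `v` with `v * x ∈ A`. -/
noncomputable def colon (x : σ) (A : Finset (σ →₀ ℕ)) : Finset (σ →₀ ℕ) :=
  (A.filter fun u => u x ≠ 0).image fun u => u - single x 1

theorem mem_colon {x : σ} {A : Finset (σ →₀ ℕ)} {v : σ →₀ ℕ} :
    v ∈ colon x A ↔ v + single x 1 ∈ A := by
  simp only [colon, Finset.mem_image, Finset.mem_filter]
  constructor
  · rintro ⟨u, ⟨hu, hx⟩, rfl⟩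
    obtain ⟨w, rfl⟩ := exists_add_single u hx
    simpa using hu
  · exact fun h => ⟨_, ⟨h, by simp⟩, by simp⟩

theorem card_colon_add (x : σ) (A : Finset (σ →₀ ℕ)) :
    (colon x A).card + (A.filter fun u => u x = 0).card = A.card := by
  rw [colon, Finset.card_image_of_injOn, add_comm]
  · exact Finset.card_filter_add_card_filter_not _
  · intro u hu v hv huv
    obtain ⟨u', rfl⟩ := exists_add_single u (Finset.mem_filter.1 hu).2
    obtain ⟨v', rfl⟩ := exists_add_single v (Finset.mem_filter.1 hv).2
    simpa using huv

theorem Stable.colon {x : σ} {A : Finset (σ →₀ ℕ)} (h : Stable x A) : Stable x (colon x A) := by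
  intro v j hv
  rw [mem_colon] at hv ⊢
  refine h _ j ?_
  rwa [add_right_comm]

/-- By stability the shadow of the `x`-free part of `A` lies in the `x`-free part of `colon x A`.
The latter is bounded with n s - 1 in place of n s, and Macaulay's bound in `V` raises this back to
n s. Allowing arbitrary `n` lets the induction decrease and shift the sequence freely. -/
theorem Stable.card_filter_le {x : σ} {V : Finset σ} (hM : MacaulayBound V) :
    ∀ (d : ℕ) (n : ℕ → ℕ) (A : Finset (σ →₀ ℕ)), Stable x A → (∀ u ∈ A, u.degree = d + 1) →
    (∀ u ∈ A, u.support ⊆ insert x V) →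
    (MonomialShadow.colon x A).card ≤ ∑ s ∈ Finset.range d, (n s).choose (s + 1) →
    (A.filter fun u => u x = 0).card ≤ ∑ s ∈ Finset.range d, (n s).choose (s + 2) := by
  intro d
  induction d with
  | zero =>
    intro n A hst hd hV hc
    have := hM 0 n (A.filter fun u => u x = 0) (MonomialShadow.colon x A)
      (fun v j hv => mem_colon.2 (hst v j (Finset.mem_filter.1 hv).1))
      (fun u hu => hd u (Finset.mem_filter.1 hu).1) (fun u hu i hi => ?_) hc
    · simpa using this
    · refine Finset.mem_of_mem_insert_of_ne (hV u (Finset.mem_filter.1 hu).1 hi) ?_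
      rintro rfl
      exact Finsupp.mem_support_iff.1 hi (Finset.mem_filter.1 hu).2
  | succ d ih =>
    intro n A hst hd hV hc
    have hB : ((MonomialShadow.colon x A).filter fun u => u x = 0).card ≤
        ∑ s ∈ Finset.range (d + 1), (n s - 1).choose (s + 1) := by
      -- If the second colon is small, induction on `d` applies to `colon x A`. If it is large,
      -- little of `colon x A` remains for the `x`-free part.
      by_cases hcase : (MonomialShadow.colon x (MonomialShadow.colon x A)).card ≤
          ∑ s ∈ Finset.range d, (n (s + 1) - 1).choose (s + 1)
      · have := ih (fun s => n (s + 1) - 1) _ hst.colon (fun u hu => ?_) (fun u hu i hi => ?_) hcase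
        · rw [Finset.sum_range_succ']
          exact this.trans (Nat.le_add_right _ _)
        · have := hd _ (mem_colon.1 hu)
          rw [map_add, Finsupp.degree_single] at this
          omega
        · refine hV _ (mem_colon.1 hu) ?_
          rw [Finsupp.mem_support_iff] at hi ⊢
          simp [hi]
      · have h1 := card_colon_add x (MonomialShadow.colon x A)
        have h2 : ∑ s ∈ Finset.range (d + 1), (n s).choose (s + 1) ≤
            ∑ s ∈ Finset.range (d + 1), ((n s - 1).choose s + (n s - 1).choose (s + 1)) := by
          refine Finset.sum_le_sum fun s _ => ?_
          rcases n s with _ | t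
          · simp
          · rw [Nat.choose_succ_succ, Nat.add_sub_cancel]
        -- The term s = 0 contributes 1, which is exactly what the strict inequality in the negation
        -- of `hcase` pays for.
        have h3 : ∑ s ∈ Finset.range (d + 1), (n s - 1).choose s =
            ∑ s ∈ Finset.range d, (n (s + 1) - 1).choose (s + 1) + 1 := by
          rw [Finset.sum_range_succ']
          simp
        rw [Finset.sum_add_distrib] at h2
        omega
    have := hM (d + 1) (fun s => n s - 1) (A.filter fun u => u x = 0) _
      (fun v j hv => ?_) (fun u hu => hd u (Finset.mem_filter.1 hu).1) (fun u hu i hi => ?_) hB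
    · refine this.trans (Finset.sum_le_sum fun s _ => ?_)
      rcases n s with _ | t
      · simp [Nat.choose_eq_zero_of_lt]
      · simp
    · rw [Finset.mem_filter] at hv ⊢
      refine ⟨mem_colon.2 (hst v j hv.1), ?_⟩
      have := hv.2
      rw [Finsupp.add_apply] at this
      omega
    · refine Finset.mem_of_mem_insert_of_ne (hV u (Finset.mem_filter.1 hu).1 hi) ?_
      rintro rfl
      exact Finsupp.mem_support_iff.1 hi (Finset.mem_filter.1 hu).2

/-- After stabilising, the multiples of `x` divided by `x` lie in B', the `x`-free part is bounded
by `Stable.card_filter_le`, and Pascal's rule adds the two bounds. -/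
theorem macaulayBound (V : Finset σ) : MacaulayBound V := by
  induction V using Finset.induction_on with
  | empty =>
    intro d n A B _ hd hV _
    have : A = ∅ := by
      rw [Finset.eq_empty_iff_forall_notMem]
      intro u hu
      have h1 : u = 0 := by simpa using hV u hu
      have h2 := hd u hu
      simp [h1] at h2
    simp [this]
  | insert x V _ ih =>
    intro d n A B hS hd hV hB
    obtain ⟨A', B', hA', hB', hS', hst, hd', hV'⟩ := exists_stable x V d _ A B le_rfl hS hd hV
    have h1 : (colon x A').card ≤ ∑ s ∈ Finset.range d, (n s).choose (s + 1) := by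
      rw [← hB'] at hB
      exact (Finset.card_le_card fun v hv => hS' v x (mem_colon.1 hv)).trans hB
    have h2 := hst.card_filter_le ih d n A' hd' hV' h1
    rw [← hA', ← card_colon_add x A']
    refine (add_le_add h1 h2).trans_eq ?_
    rw [← Finset.sum_add_distrib]
    rfl

end MonomialShadow

namespace MonomialLefschetz

open Finsupp

/-! ### An sl₂ argument and the Lefschetz property of one monomial -/

/-- Injectivity of the powers of the raising operator of an `sl₂`-triple below the middle degree,
modulo an invariant subspace. -/
theorem mem_of_pow_raise_mem {V : Type*} [AddCommGroup V] [Module ℚ V] (E F : V →ₗ[ℚ] V)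
    (N : Submodule ℚ V) (gr : ℕ → Submodule ℚ V) (k : ℕ)
    (hE : ∀ i, ∀ v ∈ gr i, E v ∈ gr (i + 1)) (hF : ∀ i, ∀ v ∈ gr (i + 1), F v ∈ gr i)
    (hF0 : ∀ v ∈ gr 0, F v = 0)
    (hEF : ∀ i, ∀ v ∈ gr i, F (E v) = E (F v) + ((k : ℚ) - 2 * i) • v)
    (hNE : ∀ v ∈ N, E v ∈ N) (hNF : ∀ v ∈ N, F v ∈ N) :
    ∀ i s, ∀ v ∈ gr i, s + 2 * i ≤ k → (E ^ s) v ∈ N → v ∈ N := by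
  have hgr : ∀ i s, ∀ v ∈ gr i, (E ^ s) v ∈ gr (i + s) := by
    intro i s v hv
    induction s with
    | zero => simpa using hv
    | succ s ih =>
      rw [pow_succ', Module.End.mul_apply]
      exact hE _ _ ih
  have hcomm : ∀ i (s : ℕ), ∀ v ∈ gr i, F ((E ^ (s + 1)) v) =
      (E ^ (s + 1)) (F v) + (((s : ℚ) + 1) * (k - 2 * i - s)) • (E ^ s) v := by
    intro i s v hv
    induction s with
    | zero => simpa using hEF i v hv
    | succ s ih =>
      rw [pow_succ' E (s + 1), Module.End.mul_apply, hEF _ _ (hgr i (s + 1) v hv), ih, map_add,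
        map_smul, Module.End.mul_apply, ← Module.End.mul_apply E (E ^ s), ← pow_succ', add_assoc,
        ← add_smul]
      congr 2
      push_cast
      ring
  intro i
  induction i with
  | zero =>
    intro s
    induction s with
    | zero => intro v _ _ h; simpa using h
    | succ s ih =>
      intro v hv hs h
      refine ih v hv (by omega) ?_
      have h1 := hNF _ h
      rw [hcomm 0 s v hv, hF0 v hv, map_zero, zero_add] at h1
      refine (Submodule.smul_mem_iff _ ?_).1 h1
      have : (s : ℚ) + 1 ≤ k := by exact_mod_cast (by omega : s + 1 ≤ k)
      refine mul_ne_zero (by positivity) ?_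
      push_cast
      linarith
  | succ i ihi =>
    intro s
    induction s with
    | zero => intro v _ _ h; simpa using h
    | succ s ih =>
      intro v hv hs h
      refine ih v hv (by omega) ?_
      have h1 := hNF _ h
      rw [hcomm (i + 1) s v hv] at h1
      -- Applying E to `h1` leaves E^(s+2) (F v) in N. As F v has degree i and (s + 2) + 2i = (s +
      -- 1) + 2(i + 1), the induction on the degree applies.
      have h2 : F v ∈ N := by
        refine ihi (s + 2) (F v) (hF i v hv) (by omega) ?_
        have h3 := hNE _ h1
        rw [map_add, map_smul, ← Module.End.mul_apply, ← Module.End.mul_apply E (E ^ s),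
          ← pow_succ', ← pow_succ'] at h3
        exact (Submodule.add_mem_iff_left _ (N.smul_mem _ h)).1 h3
      have h4 : ∀ t, (E ^ t) (F v) ∈ N := by
        intro t
        induction t with
        | zero => simpa using h2
        | succ t iht =>
          rw [pow_succ', Module.End.mul_apply]
          exact hNE _ iht
      refine (Submodule.smul_mem_iff _ ?_).1 ((Submodule.add_mem_iff_right _ (h4 _)).1 h1)
      have : (s : ℚ) + 1 + 2 * (i + 1) ≤ k := by
        exact_mod_cast (by omega : s + 1 + 2 * (i + 1) ≤ k)
      refine mul_ne_zero (by positivity) ?_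
      push_cast
      linarith

variable {σ : Type*} [Fintype σ]

/-- Multiplication by the sum of the variables, on coefficient functions. -/
noncomputable def raise : ((σ →₀ ℕ) → ℚ) →ₗ[ℚ] ((σ →₀ ℕ) → ℚ) where
  toFun f q := ∑ j, if q j = 0 then 0 else f (q - single j 1)
  map_add' f g := by
    ext q
    simp only [Pi.add_apply, ← Finset.sum_add_distrib]
    exact Finset.sum_congr rfl fun j _ => by split_ifs <;> simp
  map_smul' c f := by
    ext q
    simp [Finset.mul_sum]

theorem raise_apply (f : (σ →₀ ℕ) → ℚ) (q : σ →₀ ℕ) :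
    raise f q = ∑ j, if q j = 0 then 0 else f (q - single j 1) := rfl

/-- The lowering operator of the `sl₂`-triple on the divisors of the monomial `m`. -/
noncomputable def lower (m : σ →₀ ℕ) : ((σ →₀ ℕ) → ℚ) →ₗ[ℚ] ((σ →₀ ℕ) → ℚ) where
  toFun f q := ∑ j, ((q j : ℚ) + 1) * (m j - q j) * f (q + single j 1)
  map_add' f g := by
    ext q
    simp only [Pi.add_apply, ← Finset.sum_add_distrib, mul_add]
  map_smul' c f := by
    ext q
    simp only [Pi.smul_apply, smul_eq_mul, RingHom.id_apply, Finset.mul_sum]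
    exact Finset.sum_congr rfl fun j _ => by ring

theorem lower_apply (m : σ →₀ ℕ) (f : (σ →₀ ℕ) → ℚ) (q : σ →₀ ℕ) :
    lower m f q = ∑ j, ((q j : ℚ) + 1) * (m j - q j) * f (q + single j 1) := rfl

-- The terms with i ≠ j cancel; for i = j, (q+1)(m-q) - q(m-q+1) = m - 2q in that variable.
open Classical in
theorem lower_raise (m : σ →₀ ℕ) (f : (σ →₀ ℕ) → ℚ) (q : σ →₀ ℕ) :
    lower m (raise f) q = raise (lower m f) q + ((m.degree : ℚ) - 2 * q.degree) * f q := by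
  have hdeg : ((m.degree : ℚ) - 2 * q.degree) * f q = ∑ i, ∑ j,
      if i = j then ((m i : ℚ) - 2 * q i) * f q else 0 := by
    simp only [Finset.sum_ite_eq, Finset.mem_univ, if_true, Finsupp.degree_eq_sum]
    rw [← Finset.sum_mul, Finset.sum_sub_distrib, ← Finset.mul_sum]
    push_cast
    rfl
  have hraise : raise (lower m f) q = ∑ i, ∑ j, if q j = 0 then 0 else
      ((((q - single j 1 : σ →₀ ℕ) i : ℕ) : ℚ) + 1) * (m i - ((q - single j 1 : σ →₀ ℕ) i : ℕ)) *
        f (q - single j 1 + single i 1) := by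
    rw [Finset.sum_comm, raise_apply]
    refine Finset.sum_congr rfl fun j _ => ?_
    split_ifs <;> simp [lower_apply]
  rw [hdeg, hraise, lower_apply, ← Finset.sum_add_distrib]
  refine Finset.sum_congr rfl fun i _ => ?_
  rw [raise_apply, Finset.mul_sum, ← Finset.sum_add_distrib]
  refine Finset.sum_congr rfl fun j _ => ?_
  by_cases hij : i = j
  · subst hij
    by_cases hq : q i = 0
    · simp [hq]
    · obtain ⟨p, rfl⟩ := MonomialShadow.exists_add_single q hq
      simp
      ring
  · by_cases hq : q j = 0
    · simp [hq, hij]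
    · obtain ⟨p, rfl⟩ := MonomialShadow.exists_add_single q hq
      have h1 : p + single j 1 + single i 1 - single j 1 = p + single i 1 := by
        rw [add_right_comm, add_tsub_cancel_right]
      rw [h1]
      simp [hij, Ne.symm hij]

theorem raise_eq_zero {f : (σ →₀ ℕ) → ℚ} {i : ℕ} (hf : ∀ q, q.degree ≠ i → f q = 0)
    (q : σ →₀ ℕ) (hq : q.degree ≠ i + 1) : raise f q = 0 := by
  rw [raise_apply]
  refine Finset.sum_eq_zero fun j _ => ?_
  split_ifs with h0
  · rfl
  · obtain ⟨p, rfl⟩ := MonomialShadow.exists_add_single q h0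
    rw [map_add, Finsupp.degree_single] at hq
    rw [add_tsub_cancel_right]
    exact hf p (by omega)

theorem raise_pow_eq_zero {f : (σ →₀ ℕ) → ℚ} {i : ℕ} (hf : ∀ q, q.degree ≠ i → f q = 0) (s : ℕ) :
    ∀ q : σ →₀ ℕ, q.degree ≠ i + s → (raise ^ s) f q = 0 := by
  induction s with
  | zero => simpa using hf
  | succ s ih =>
    rw [pow_succ', Module.End.mul_apply]
    exact raise_eq_zero ih

/-- Let `f` be of degree `i` and `2 * i + s ≤ deg m`. If `(∑ x)^s * f` vanishes on the divisors
of `m` of degree `i + s`, then `f` vanishes on the divisors of `m`. -/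
theorem eq_zero_of_pow_raise (m : σ →₀ ℕ) {i s : ℕ} (his : s + 2 * i ≤ m.degree)
    (f : (σ →₀ ℕ) → ℚ) (hf : ∀ q, q.degree ≠ i → f q = 0)
    (h : ∀ q ≤ m, q.degree = i + s → (raise ^ s) f q = 0) : ∀ q ≤ m, f q = 0 := by
  -- The quotient by N consists of the functions on the divisors of `m`, the coefficients in
  -- ℚ[x]/(x_j^{m_j+1}).
  let N : Submodule ℚ ((σ →₀ ℕ) → ℚ) :=
    { carrier := {f | ∀ q ≤ m, f q = 0}
      add_mem' := fun {f g} hf hg q hq => by simp [hf q hq, hg q hq]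
      zero_mem' := fun q _ => rfl
      smul_mem' := fun c f hf q hq => by simp [hf q hq] }
  let gr : ℕ → Submodule ℚ ((σ →₀ ℕ) → ℚ) := fun i =>
    { carrier := {f | ∀ q, q.degree ≠ i → f q = 0}
      add_mem' := fun {f g} hf hg q hq => by simp [hf q hq, hg q hq]
      zero_mem' := fun q _ => rfl
      smul_mem' := fun c f hf q hq => by simp [hf q hq] }
  refine mem_of_pow_raise_mem raise (lower m) N gr m.degree ?_ ?_ ?_ ?_ ?_ ?_ i s f hf his
    fun q hq => ?_
  · exact fun i v hv => raise_eq_zero hv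
  · intro i v hv q hq
    rw [lower_apply]
    refine Finset.sum_eq_zero fun j _ => ?_
    rw [hv, mul_zero]
    rw [map_add, Finsupp.degree_single]
    omega
  · intro v hv
    ext q
    rw [lower_apply]
    refine Finset.sum_eq_zero fun j _ => ?_
    rw [hv, mul_zero]
    rw [map_add, Finsupp.degree_single]
    omega
  · intro i v hv
    ext q
    rw [lower_raise, Pi.add_apply, Pi.smul_apply, smul_eq_mul]
    by_cases hq : q.degree = i
    · rw [hq]
    · rw [hv q hq, mul_zero, mul_zero]
  · intro v hv q hq
    rw [raise_apply]
    refine Finset.sum_eq_zero fun j _ => ?_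
    split_ifs
    · rfl
    · exact hv _ (tsub_le_self.trans hq)
  · intro v hv q hq
    rw [lower_apply]
    refine Finset.sum_eq_zero fun j _ => ?_
    -- The factor m j - q j vanishes precisely when q·x_j no longer divides `m`.
    rcases (hq j).lt_or_eq with h1 | h1
    · rw [hv, mul_zero]
      intro l
      rcases eq_or_ne j l with rfl | hl
      · simpa using h1
      · simpa [hl] using hq l
    · simp [h1]
  · by_cases hd : q.degree = i + s
    · exact h q hq hd
    · exact raise_pow_eq_zero hf s q hd

end MonomialLefschetz

namespace MonomialLefschetz

open Finsupp

/-! ### Leading positions of a space of functions -/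

/-- The functions that vanish outside `S`. -/
def supportedOn {α : Type*} (S : Set α) : Submodule ℚ (α → ℚ) where
  carrier := {f | ∀ q, q ∉ S → f q = 0}
  add_mem' := fun {f g} hf hg q hq => by simp [hf q hq, hg q hq]
  zero_mem' := fun q _ => rfl
  smul_mem' := fun c f hf q hq => by simp [hf q hq]

open Classical in
/-- A function that vanishes outside `S` is determined by its restriction to `S`. -/
noncomputable def supportedOnEquiv {α : Type*} (S : Set α) : supportedOn S ≃ₗ[ℚ] (S → ℚ) :=
  LinearEquiv.ofBijective ((LinearMap.funLeft ℚ ℚ ((↑) : S → α)).comp (supportedOn S).subtype) <| by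
    constructor
    · rw [← LinearMap.ker_eq_bot, LinearMap.ker_eq_bot']
      intro f hf
      ext q
      by_cases hq : q ∈ S
      · exact congr_fun hf ⟨q, hq⟩
      · exact f.2 q hq
    · intro g
      refine ⟨⟨fun q => if h : q ∈ S then g ⟨q, h⟩ else 0, fun q hq => by simp [hq]⟩, ?_⟩
      ext q
      simp [LinearMap.funLeft]

theorem finiteDimensional_supportedOn {α : Type*} {S : Set α} (hS : S.Finite) :
    FiniteDimensional ℚ (supportedOn S) := by
  have := hS.to_subtype
  exact (supportedOnEquiv S).symm.finiteDimensional

theorem finrank_supportedOn {α : Type*} {S : Set α} (hS : S.Finite) :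
    Module.finrank ℚ (supportedOn S) = S.ncard := by
  have := hS.fintype
  rw [(supportedOnEquiv S).finrank_eq, Module.finrank_fintype_fun_eq_card,
    ← Nat.card_eq_fintype_card, Nat.card_coe_set_eq]

/-- The positions of the leading terms of the members of `W`, in the order given by `τ`. -/
def leading {α β : Type*} [LinearOrder β] (τ : α → β) (W : Submodule ℚ (α → ℚ)) : Set α :=
  {q | ∃ f ∈ W, f q ≠ 0 ∧ ∀ p, τ q < τ p → f p = 0}

theorem leading_subset {α β : Type*} [LinearOrder β] (τ : α → β) {W : Submodule ℚ (α → ℚ)}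
    {S : Set α} (hW : W ≤ supportedOn S) : leading τ W ⊆ S := by
  rintro q ⟨f, hf, hq, -⟩
  by_contra h
  exact hq (hW hf q h)

/-- As in Gaussian elimination: members with distinct leading positions are independent, and a
member vanishing at all leading positions is zero. -/
theorem ncard_leading {α β : Type*} [LinearOrder β] {τ : α → β} (hτ : Function.Injective τ)
    {W : Submodule ℚ (α → ℚ)} {S : Set α} (hS : S.Finite) (hW : W ≤ supportedOn S) :
    (leading τ W).ncard = Module.finrank ℚ W := by
  have hfin := hS.subset (leading_subset τ hW)
  have := hfin.fintype
  have := finiteDimensional_supportedOn hS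
  have : FiniteDimensional ℚ W := Submodule.finiteDimensional_of_le hW
  rw [← Nat.card_coe_set_eq, Nat.card_eq_fintype_card]
  apply le_antisymm
  · choose f hfW hf hlt using fun q : leading τ W => q.2
    have hli : LinearIndependent ℚ fun q : leading τ W => (⟨f q, hfW q⟩ : W) := by
      rw [linearIndependent_iff']
      intro s g hg
      by_contra hne
      push Not at hne
      obtain ⟨q₀, hq₀, hgq₀⟩ := hne
      obtain ⟨q, hq, hmax⟩ := Finset.exists_max_image (s.filter fun q => g q ≠ 0)
        (fun q => τ q) ⟨q₀, Finset.mem_filter.2 ⟨hq₀, hgq₀⟩⟩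
      rw [Finset.mem_filter] at hq
      have h1 : ∑ p ∈ s, g p * f p q = 0 := by
        have := congr_fun (congr_arg (Subtype.val) hg) q
        simpa [Finset.sum_apply] using this
      rw [Finset.sum_eq_single_of_mem q hq.1] at h1
      · exact (mul_ne_zero hq.2 (hf q)) h1
      · intro p hp hpq
        by_cases hgp : g p = 0
        · rw [hgp, zero_mul]
        · have hle := hmax p (Finset.mem_filter.2 ⟨hp, hgp⟩)
          rw [hlt p q (lt_of_le_of_ne hle fun h => hpq (Subtype.ext (hτ h))), mul_zero]
    exact hli.fintype_card_le_finrank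
  · have hinj : Function.Injective
        ((LinearMap.funLeft ℚ ℚ ((↑) : leading τ W → α)).comp W.subtype) := by
      rw [← LinearMap.ker_eq_bot, LinearMap.ker_eq_bot']
      intro f hf
      by_contra hne
      have hne' : ∃ q, f.1 q ≠ 0 := by
        by_contra h
        push Not at h
        exact hne (Subtype.ext (funext h))
      obtain ⟨q₀, hq₀⟩ := hne'
      have hmem : ∀ q, f.1 q ≠ 0 → q ∈ S := fun q hq => by
        by_contra h
        exact hq (hW f.2 q h)
      obtain ⟨q, hq, hmax⟩ := Finset.exists_max_image (hS.toFinset.filter fun q => f.1 q ≠ 0)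
        τ ⟨q₀, by simp [hq₀, hmem]⟩
      rw [Finset.mem_filter] at hq
      refine hq.2 (congr_fun hf ⟨q, f.1, f.2, hq.2, fun p hp => ?_⟩)
      by_contra hfp
      exact absurd (hmax p (by simp [hfp, hmem])) (not_le.2 hp)
    have := LinearMap.finrank_le_finrank_of_injective hinj
    rwa [Module.finrank_fintype_fun_eq_card] at this

variable {σ ι : Type*}

/-! ### Lefschetz injectivity for pure families -/

/-- The monomials of degree `l` that divide one of the monomials `m a`. -/
def divisors (m : ι → σ →₀ ℕ) (l : ℕ) : Set (σ →₀ ℕ) := {q | q.degree = l ∧ ∃ a, q ≤ m a}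

theorem mem_divisors_of_add_single {m : ι → σ →₀ ℕ} {l : ℕ} {q : σ →₀ ℕ} {j : σ}
    (h : q + single j 1 ∈ divisors m (l + 1)) : q ∈ divisors m l := by
  obtain ⟨h1, a, ha⟩ := h
  rw [map_add, Finsupp.degree_single] at h1
  exact ⟨by omega, a, le_self_add.trans ha⟩

variable [Fintype σ]

theorem finite_divisors (m : ι → σ →₀ ℕ) (l : ℕ) : (divisors m l).Finite := by
  classical
  refine (Finset.univ.finsuppAntidiag l : Finset (σ →₀ ℕ)).finite_toSet.subset ?_
  rintro q ⟨hq, -⟩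
  rw [Finset.mem_coe, Finset.mem_finsuppAntidiag]
  exact ⟨by rw [← hq, Finsupp.degree_eq_sum], Finset.subset_univ _⟩

/-- Vanishing can be tested on the divisors of one m a at a time; purity gives the same bound k for
each of them. -/
theorem eq_zero_of_pow_raise_divisors {m : ι → σ →₀ ℕ} {k : ℕ} (hm : ∀ a, (m a).degree = k)
    {i s : ℕ} (his : s + 2 * i ≤ k) {f : (σ →₀ ℕ) → ℚ} (hf : f ∈ supportedOn (divisors m i))
    (h : ∀ q ∈ divisors m (i + s), (raise ^ s) f q = 0) : f = 0 := by
  ext q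
  by_cases hq : q ∈ divisors m i
  · obtain ⟨a, ha⟩ := hq.2
    exact eq_zero_of_pow_raise (m a) (by rw [hm a]; exact his) f
      (fun p hp => hf p fun h' => hp h'.1) (fun p hp hd => h p ⟨hd, a, hp⟩) q ha
  · exact hf q hq

theorem ncard_divisors_le {m : ι → σ →₀ ℕ} {k : ℕ} (hm : ∀ a, (m a).degree = k)
    {i j : ℕ} (hij : i ≤ j) (hk : i + j ≤ k) : (divisors m i).ncard ≤ (divisors m j).ncard := by
  obtain ⟨s, rfl⟩ := Nat.exists_eq_add_of_le hij
  have hfin := finite_divisors m i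
  have := (finite_divisors m (i + s)).fintype
  have := finiteDimensional_supportedOn hfin
  have hinj : Function.Injective ((LinearMap.funLeft ℚ ℚ
      ((↑) : divisors m (i + s) → (σ →₀ ℕ))).comp
        ((raise ^ s).comp (supportedOn (divisors m i)).subtype)) := by
    rw [← LinearMap.ker_eq_bot, LinearMap.ker_eq_bot']
    intro f hf
    exact Subtype.ext (eq_zero_of_pow_raise_divisors hm (by omega) f.2
      fun q hq => congr_fun hf ⟨q, hq⟩)
  have := LinearMap.finrank_le_finrank_of_injective hinj
  rwa [Module.finrank_fintype_fun_eq_card, finrank_supportedOn hfin, ← Nat.card_eq_fintype_card,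
    Nat.card_coe_set_eq] at this

/-! ### Primitive spaces and the g-inequalities -/

/-- The transpose of `raise`. -/
noncomputable def contract : ((σ →₀ ℕ) → ℚ) →ₗ[ℚ] ((σ →₀ ℕ) → ℚ) where
  toFun f q := ∑ j, f (q + single j 1)
  map_add' f g := by
    ext q
    simp [Finset.sum_add_distrib]
  map_smul' c f := by
    ext q
    simp [Finset.mul_sum]

theorem contract_apply (f : (σ →₀ ℕ) → ℚ) (q : σ →₀ ℕ) :
    contract f q = ∑ j, f (q + single j 1) := rfl

theorem contract_mem (m : ι → σ →₀ ℕ) (l : ℕ) :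
    ∀ f ∈ supportedOn (divisors m (l + 1)), contract f ∈ supportedOn (divisors m l) := by
  intro f hf q hq
  rw [contract_apply]
  exact Finset.sum_eq_zero fun j _ => hf _ fun h => hq (mem_divisors_of_add_single h)

open Classical in
theorem contract_single (p : σ →₀ ℕ) : contract (Pi.single p (1 : ℚ)) =
    ∑ j, if p j = 0 then 0 else Pi.single (p - single j 1) (1 : ℚ) := by
  ext q
  rw [contract_apply, Finset.sum_apply]
  refine Finset.sum_congr rfl fun j _ => ?_
  split_ifs with h
  · rw [Pi.single_apply, if_neg, Pi.zero_apply]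
    rintro rfl
    simp at h
  · obtain ⟨p, rfl⟩ := MonomialShadow.exists_add_single p h
    simp [Pi.single_apply]

-- Dual to injectivity of `raise`: a functional killing the image, read as a coefficient function f,
-- satisfies raise f = 0 on the divisors of degree l + 1, so f = 0.
open Classical in
theorem contract_surjective {m : ι → σ →₀ ℕ} {k : ℕ} (hm : ∀ a, (m a).degree = k)
    {l : ℕ} (hl : 2 * l + 1 ≤ k) :
    Function.Surjective (contract.restrict (contract_mem m l)) := by
  have hfin := finite_divisors m l
  have := finiteDimensional_supportedOn hfin
  have hsingle : ∀ l, ∀ p ∈ divisors m l, Pi.single p (1 : ℚ) ∈ supportedOn (divisors m l) := by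
    intro l p hp q hq
    rw [Pi.single_apply, if_neg]
    rintro rfl
    exact hq hp
  rw [← LinearMap.dualMap_injective_iff, ← LinearMap.ker_eq_bot, LinearMap.ker_eq_bot']
  intro φ hφ
  obtain ⟨ψ, hψ⟩ := LinearMap.exists_extend φ
  have hψ' : ∀ f (hf : f ∈ supportedOn (divisors m l)), ψ f = φ ⟨f, hf⟩ := fun f hf =>
    LinearMap.congr_fun hψ ⟨f, hf⟩
  let f : (σ →₀ ℕ) → ℚ := fun q => if q ∈ divisors m l then ψ (Pi.single q 1) else 0
  have hf : f ∈ supportedOn (divisors m l) := fun q hq => if_neg hq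
  have hf0 : f = 0 := by
    refine eq_zero_of_pow_raise_divisors hm (s := 1) (by omega) hf fun p hp => ?_
    rw [pow_one, raise_apply]
    have h1 : ψ (contract (Pi.single p 1)) = 0 := by
      rw [hψ' _ (contract_mem m l _ (hsingle _ p hp))]
      exact LinearMap.congr_fun hφ ⟨_, hsingle _ p hp⟩
    rw [contract_single, map_sum] at h1
    refine Eq.trans ?_ h1
    refine Finset.sum_congr rfl fun j _ => ?_
    split_ifs with h
    · rw [map_zero]
    · refine if_pos (mem_divisors_of_add_single (j := j) ?_)
      rwa [tsub_add_cancel_of_le (Finsupp.single_le_iff.2 (by omega))]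
  ext g
  have hg : g.1 = ∑ q ∈ hfin.toFinset, g.1 q • Pi.single q (1 : ℚ) := by
    ext p
    rw [Finset.sum_apply]
    simp only [Pi.smul_apply, Pi.single_apply, smul_eq_mul, mul_ite, mul_one, mul_zero,
      Finset.sum_ite_eq, Set.Finite.mem_toFinset]
    split_ifs with hp
    · rfl
    · exact g.2 p hp
  have hφg : φ g = ψ g.1 := (hψ' g.1 g.2).symm
  rw [hφg, hg, map_sum, LinearMap.zero_apply]
  refine Finset.sum_eq_zero fun q hq => ?_
  have h2 : ψ (Pi.single q 1) = 0 := by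
    have := congr_fun hf0 q
    simpa [f, hfin.mem_toFinset.1 hq] using this
  rw [map_smul, h2, smul_zero]

/-- The kernel of `contract` in degree `l`. -/
noncomputable def primitive (m : ι → σ →₀ ℕ) (l : ℕ) : Submodule ℚ ((σ →₀ ℕ) → ℚ) :=
  supportedOn (divisors m l) ⊓ LinearMap.ker contract

theorem finrank_primitive {m : ι → σ →₀ ℕ} {k : ℕ} (hm : ∀ a, (m a).degree = k)
    {l : ℕ} (hl : 2 * l + 1 ≤ k) :
    (divisors m l).ncard + Module.finrank ℚ (primitive m (l + 1)) = (divisors m (l + 1)).ncard := by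
  have hfin := finite_divisors m (l + 1)
  have := finiteDimensional_supportedOn hfin
  have h1 := LinearMap.finrank_range_add_finrank_ker (contract.restrict (contract_mem m l))
  rw [LinearMap.range_eq_top.2 (contract_surjective hm hl), finrank_top,
    finrank_supportedOn (finite_divisors m l), finrank_supportedOn hfin] at h1
  have h2 : (LinearMap.ker (contract.restrict (contract_mem m l))).map
      (supportedOn (divisors m (l + 1))).subtype = primitive m (l + 1) := by
    ext f
    simp only [Submodule.mem_map, LinearMap.mem_ker, primitive, Submodule.mem_inf]
    constructor
    · rintro ⟨g, hg, rfl⟩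
      exact ⟨g.2, congr_arg Subtype.val hg⟩
    · rintro ⟨hf, hc⟩
      exact ⟨⟨f, hf⟩, Subtype.ext hc, rfl⟩
  rw [← h2, Submodule.finrank_map_subtype_eq]
  exact h1

/-- The shift by e_j commutes with `contract`, and the lexicographic order is translation invariant,
so the shifted function has leading monomial q. -/
theorem mem_leading_of_add_single [LinearOrder σ] {m : ι → σ →₀ ℕ} {l : ℕ} {q : σ →₀ ℕ} {j : σ}
    (h : q + single j 1 ∈ leading toLex (primitive m (l + 1))) :
    q ∈ leading toLex (primitive m l) := by
  obtain ⟨f, ⟨hf, hc⟩, hq, hlt⟩ := h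
  refine ⟨fun p => f (p + single j 1), ⟨fun p hp => ?_, ?_⟩, hq, fun p hp => ?_⟩
  · exact hf _ fun h => hp (mem_divisors_of_add_single h)
  · rw [SetLike.mem_coe, LinearMap.mem_ker] at hc ⊢
    ext p
    have := congr_fun hc (p + single j 1)
    rw [contract_apply] at this ⊢
    refine Eq.trans ?_ this
    exact Finset.sum_congr rfl fun i _ => by rw [add_right_comm]
  · refine hlt _ ?_
    rw [toLex_add, toLex_add]
    exact add_lt_add_left hp _

/-- Macaulay's bound for the differences of the numbers of divisors in the lower half. -/
theorem finrank_primitive_succ_le (m : ι → σ →₀ ℕ) (d : ℕ) (n : ℕ → ℕ)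
    (h : Module.finrank ℚ (primitive m d) ≤ ∑ s ∈ Finset.range d, (n s).choose (s + 1)) :
    Module.finrank ℚ (primitive m (d + 1)) ≤
      ∑ s ∈ Finset.range d, (n s + 1).choose (s + 2) := by
  classical
  let _ : LinearOrder σ := LinearOrder.lift' _ (Fintype.equivFin σ).injective
  have hle : ∀ l, primitive m l ≤ supportedOn (divisors m l) := fun l => inf_le_left
  have hfin : ∀ l, (leading toLex (primitive m l)).Finite := fun l =>
    (finite_divisors m l).subset (leading_subset _ (hle l))
  have hcard : ∀ l, (hfin l).toFinset.card = Module.finrank ℚ (primitive m l) := fun l => by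
    rw [← Set.ncard_eq_toFinset_card _ (hfin l),
      ncard_leading toLex.injective (finite_divisors m l) (hle l)]
  rw [← hcard] at h ⊢
  refine MonomialShadow.macaulayBound Finset.univ d n _ _ ?_ ?_ ?_ h
  · intro v j hv
    rw [Set.Finite.mem_toFinset] at hv ⊢
    exact mem_leading_of_add_single hv
  · intro u hu
    exact (leading_subset _ (hle _) ((hfin _).mem_toFinset.1 hu)).1
  · exact fun u _ => Finset.subset_univ _

end MonomialLefschetz

/-! ### From divisor counts to the matroid h-vector -/

open MonomialLefschetz in
theorem corollary3 (stanley : MatroidH.StanleyConjecture)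
    (n k : ℕ) (M : Matroid (Fin n)) (hE : M.E = Set.univ) (hloopless : M.Loopless)
    (hcoloop : ∀ e, ¬ M.IsColoop e) (hrank : M.eRank = (k : ℕ∞)) :
    (∀ i j : ℕ, i ≤ j → i + j ≤ k → MatroidH.hNumber M k i ≤ MatroidH.hNumber M k j) ∧
      MatroidH.GInequalities k (MatroidH.hNumber M k) := by
  obtain ⟨h, ⟨hpos, m, hm, hcount⟩, hh⟩ := stanley n k M hE hloopless hcoloop hrank
  have hzero : MatroidH.hNumber M k 0 = 1 := by
    have : {F : Finset (Fin n) | F.card = 0 ∧ M.Indep (F : Set (Fin n))} = {∅} := by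
      ext F
      simp only [Finset.card_eq_zero, Set.mem_ofPred_eq, Set.mem_singleton_iff]
      exact ⟨fun h => h.1, fun h => ⟨h, by simp [h]⟩⟩
    have hf : MatroidH.numFaces M 0 = 1 := by rw [MatroidH.numFaces, this, Set.ncard_singleton]
    simp [MatroidH.hNumber, hf]
  have hdiv : ∀ i ≤ k, MatroidH.hNumber M k i = ((divisors m i).ncard : ℤ) := by
    intro i hi
    rcases Nat.eq_zero_or_pos i with rfl | hi0
    -- The pure O-sequence says nothing about degree 0; `hpos` supplies a monomial for 1 to divide.
    · have : divisors m 0 = {0} := by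
        ext q
        simp only [divisors, Set.mem_ofPred_eq, Set.mem_singleton_iff, Finsupp.degree_eq_zero_iff]
        exact ⟨fun h => h.1, fun h => ⟨h, ⟨0, hpos⟩, by simp [h]⟩⟩
      rw [hzero, this, Set.ncard_singleton, Nat.cast_one]
    · rw [hh i hi0 hi, hcount i hi0 hi]
      rfl
  have hg : ∀ i, 1 ≤ i → i ≤ k / 2 → MatroidH.gNumber (MatroidH.hNumber M k) i =
      (Module.finrank ℚ (primitive m i) : ℤ) := by
    intro i hi hik
    obtain ⟨l, rfl⟩ := Nat.exists_eq_add_of_le' hi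
    have := finrank_primitive hm (l := l) (by omega)
    rw [MatroidH.gNumber, Nat.add_sub_cancel, hdiv _ (by omega), hdiv _ (by omega), ← this]
    push_cast
    ring
  refine ⟨fun i j hij hk => ?_, fun i hi hik => ?_, fun i hi hik r ν hr hri _ _ hsum => ?_⟩
  · rw [hdiv i (by omega), hdiv j (by omega)]
    exact_mod_cast ncard_divisors_le hm hij hk
  · rw [hg i hi hik]
    exact Nat.cast_nonneg _
  · rw [hg i hi hik.le] at hsum
    rw [hg (i + 1) (by omega) (by omega)]
    -- extend the expansion by zeros to the positions below `r`
    have key : ∀ c : ℕ → ℕ → ℕ, (∀ s, 1 ≤ s → c 0 s = 0) →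
        ∑ s ∈ Finset.Icc r i, c (ν s) s =
          ∑ s ∈ Finset.range i, c (if r ≤ s + 1 then ν (s + 1) else 0) (s + 1) := by
      intro c hc
      rw [Finset.sum_congr rfl fun s (hs : s ∈ Finset.range i) => (apply_ite (c · (s + 1)) _ _ _).trans
        (by rw [hc (s + 1) (by omega)]), ← Finset.sum_filter]
      refine Finset.sum_bij' (fun s _ => s - 1) (fun s _ => s + 1) ?_ ?_ ?_ ?_ ?_ <;>
        simp only [Finset.mem_Icc, Finset.mem_filter, Finset.mem_range]
      · omega
      · omega
      · omega
      · omega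
      · intro s hs
        rw [Nat.sub_add_cancel (by omega)]
    have h1 := key Nat.choose (fun s hs => Nat.choose_eq_zero_of_lt hs)
    have h2 := key (fun a s => (a + 1).choose (s + 1)) (fun s hs =>
      Nat.choose_eq_zero_of_lt (by omega))
    have h3 := finrank_primitive_succ_le m i (fun s => if r ≤ s + 1 then ν (s + 1) else 0) (by
      rw [← h1]
      exact_mod_cast hsum.le)
    rw [← h2] at h3
    exact_mod_cast h3
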